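/- An algebraic circuit over a field $\mathbb F$ is a finite directed acyclic graph whose leaves are labelled by variables or elements of $\mathbb F$ and whose internal nodes are labelled by $+$ or $\times$ (with unbounded non-zero fan-in); each node computes a polynomial in the natural way, the output nodes are those of out-degree zero, and the size is the number of wires. Write $\mathbb F[x_1,\dots,x_n]^d$ for the space of polynomials of total degree at most $d$, let $M_{n,d}$ be the set of the $N_{n,d}=\binom{n+d}{d}$ exponent vectors $a$ with $|a|\le d$, and let $\mathrm{coeff}_{n,d}(f)\in\mathbb F^{M_{n,d}}$ be the coefficient vector of $f\in\mathbb F[x_1,\dots,x_n]^d$. Let $\mathcal C_{n,d,s}(\mathbb F)$ be the set of $f\in\mathbb F[x_1,\dots,x_n]^d$ computed by a circuit of size at most $s$. Let $\mathcal D\subseteq\mathbb F[c_a : a\in M_{n,d}]$. There is an $s$-succinct hitting set for $\mathcal D$ if for every $D\in\mathcal D$: $D\ne 0$ iff $D(\mathrm{coeff}_{n,d}(f))\neq 0$ for some $f\in\mathcal C_{n,d,s}(\mathbb F)$. A tuple of polynomials $\mathcal G=(\mathcal G_a)_{a\in M_{n,d}}$ in $\mathbb F[y_1,\dots,y_r]$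 is an $s'$-succinct generator for $\mathcal D$ computable by size-$s'$ circuits if, with $G(x,y)=\sum_{a\in M_{n,d}}\mathcal G_a(y)\,x^a$: (1) $G$ is computed by a circuit of size at most $s'$; (2) $G(x,\alpha)\in\mathcal C_{n,d,s'}(\mathbb F)$ for every $\alpha\in\mathbb F^r$; (3) for every $D\in\mathcal D$, $D\neq 0$ iff $D(\mathcal G(y))\ne 0$ as a polynomial in $\mathbb F[y_1,\dots,y_r]$. **Lemma.** There are polynomials $p\in\mathbb N[t_1,t_2,t_3]$ and $q\in\mathbb N[t]$ such that for every field $\mathbb F$ and all integers $n,s\ge 1$ and $d\ge 0$ there are $r\le p(n,d,s)$ and a polynomial $U(x,y)\in\mathbb F[x_1,\dots,x_n,y_1,\dots,y_r]$ (a universal circuit), computed by a circuit of size at most $p(n,d,s)$, with $\deg_x U\le d$ and $\deg_y U\le q(d)$, such that every $f\in\mathcal C_{n,d,s}(\mathbb F)$ equals $U(x,\alpha)$ for some $\alpha\in\mathbb F^r$, and such that the following holds. For every $\mathcal D\subseteq\mathbb F[c_a : a\in M_{n,d}]$, if there is an $s$-succinct hitting set for $\mathcal D$, then the tuple $\mathcal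 G$ of the coefficients of $U$ with respect to the monomials $x^a$, $a\in M_{n,d}$ (so that $G=U$), is a $p(n,d,s)$-succinct generator for $\mathcal D$ computable by size-$p(n,d,s)$ circuits. -/

import Mathlib

open MvPolynomial

noncomputable section

/-! ## Algebraic circuits -/

/-- A node of an algebraic circuit whose wires come from nodes with index `< m`: a leaf, labelled by
a variable or a field element, or an internal addition or multiplication node. The list of an
internal node has one entry for each incoming wire; the fan-in is unbounded, but not zero. -/
inductive CircuitNode (F : Type*) (σ : Type*) (m : ℕ) where
  | var (i : σ)
  | const (c : F)
  | add (inputs : List (Fin m)) (nonempty : inputs ≠ [])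
  | mul (inputs : List (Fin m)) (nonempty : inputs ≠ [])

/-- The origins of the incoming wires of a node, with multiplicity. -/
def CircuitNode.inputs {F σ : Type*} {m : ℕ} : CircuitNode F σ m → List (Fin m)
  | .var _ => []
  | .const _ => []
  | .add l _ => l
  | .mul l _ => l

/-- An algebraic circuit over `F` in the variables `σ`: a finite directed acyclic graph, whose nodes
are listed in a topological order, so that the wires into node `i` come from nodes `j < i`. -/
structure AlgCircuit (F : Type*) (σ : Type*) where
  numNodes : ℕ
  node : (i : Fin numNodes) → CircuitNode F σ i

/-- The size of a circuit is its number of wires. -/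
def AlgCircuit.size {F σ : Type*} (A : AlgCircuit F σ) : ℕ :=
  ∑ i, (A.node i).inputs.length

/-- The output nodes are the nodes of out-degree zero. -/
def AlgCircuit.IsOutput {F σ : Type*} (A : AlgCircuit F σ) (o : Fin A.numNodes) : Prop :=
  ∀ i, ∀ j ∈ (A.node i).inputs, (j : ℕ) ≠ o

/-- The polynomial computed at a node. -/
def AlgCircuit.value {F σ : Type*} [Field F] (A : AlgCircuit F σ) (i : Fin A.numNodes) :
    MvPolynomial σ F :=
  match A.node i with
  | .var v => X v
  | .const c => C c
  | .add l _ => (l.map fun j : Fin i => A.value ⟨j, j.2.trans i.2⟩).sum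
  | .mul l _ => (l.map fun j : Fin i => A.value ⟨j, j.2.trans i.2⟩).prod
termination_by i.val
decreasing_by all_goals exact j.isLt

/-- The class of polynomials that are computed (at an output node) by some circuit of size at
most `s`. -/
def circuitClass (F : Type*) [Field F] (σ : Type*) (s : ℕ) : Set (MvPolynomial σ F) :=
  {f | ∃ (A : AlgCircuit F σ) (o : Fin A.numNodes), A.IsOutput o ∧ A.size ≤ s ∧ A.value o = f}

/-- The polynomials of total degree at most `d` in `x_1, …, x_n` that are computed by some circuit
of size at most `s`. (The total degree of the zero polynomial is `0`.) -/
def boundedCircuitClass (F : Type*) [Field F] (n d s : ℕ) : Set (MvPolynomial (Fin n) F) :=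
  {f | f.totalDegree ≤ d ∧ f ∈ circuitClass F (Fin n) s}

/-! ## Coefficient vectors, succinct hitting sets, succinct generators

A finite set of monomials is given by the finite set `M` of their exponent vectors. -/

/-- The exponent vectors of the monomials of total degree at most `d` in `n` variables. -/
def monomialsLE (n d : ℕ) : Finset (Fin n →₀ ℕ) :=
  (Finset.range (d + 1)).biUnion fun k => Finset.univ.finsuppAntidiag k

theorem mem_monomialsLE {n d : ℕ} {a : Fin n →₀ ℕ} :
    a ∈ monomialsLE n d ↔ ∑ i, a i ≤ d := by
  simp [monomialsLE, Finset.mem_finsuppAntidiag]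

/-- The coefficient vector of `f` with respect to the monomials `M`. -/
def coeffVec {F : Type*} [Field F] {n : ℕ} (M : Finset (Fin n →₀ ℕ)) (f : MvPolynomial (Fin n) F) :
    M → F :=
  fun a => coeff (a : Fin n →₀ ℕ) f

/-- `𝒞` is a `𝒞`-succinct hitting set for `𝒟`: `𝒞` lies in the span of the monomials `M`, and its
coefficient vectors are a hitting set for `𝒟`. -/
def IsSuccinctHittingSet {F : Type*} [Field F] {n : ℕ} (M : Finset (Fin n →₀ ℕ))
    (𝒞 : Set (MvPolynomial (Fin n) F)) (𝒟 : Set (MvPolynomial M F)) : Prop :=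
  (∀ f ∈ 𝒞, f.support ⊆ M) ∧
    ∀ D ∈ 𝒟, D ≠ 0 ↔ ∃ f ∈ 𝒞, eval (coeffVec M f) D ≠ 0

/-- The polynomial `G(x, y) = ∑_{a ∈ M} 𝒢_a(y) x^a` of a polynomial map `𝒢 : F^ℓ → F^M`. -/
def generatorPoly {F : Type*} [Field F] {n ℓ : ℕ} {M : Finset (Fin n →₀ ℕ)}
    (𝒢 : M → MvPolynomial (Fin ℓ) F) : MvPolynomial (Fin n ⊕ Fin ℓ) F :=
  ∑ a : M, rename Sum.inr (𝒢 a) * rename Sum.inl (monomial (a : Fin n →₀ ℕ) (1 : F))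

/-- `G(x, α)`: the substitution of scalars `α` for the variables `y`. -/
def specializeY {F : Type*} [Field F] {n ℓ : ℕ} (α : Fin ℓ → F)
    (G : MvPolynomial (Fin n ⊕ Fin ℓ) F) : MvPolynomial (Fin n) F :=
  aeval (Sum.elim X fun j => C (α j)) G

/-- The polynomial map `𝒢 : F^ℓ → F^M` is a `𝒞`-succinct generator for `𝒟` computable in `𝒞'`. -/
structure IsSuccinctGenerator {F : Type*} [Field F] {n ℓ : ℕ} {M : Finset (Fin n →₀ ℕ)}
    (𝒞 : Set (MvPolynomial (Fin n) F)) (𝒞' : Set (MvPolynomial (Fin n ⊕ Fin ℓ) F))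
    (𝒟 : Set (MvPolynomial M F)) (𝒢 : M → MvPolynomial (Fin ℓ) F) : Prop where
  subset_span : ∀ f ∈ 𝒞, f.support ⊆ M
  computable : generatorPoly 𝒢 ∈ 𝒞'
  succinct : ∀ α : Fin ℓ → F, specializeY α (generatorPoly 𝒢) ∈ 𝒞
  generates : ∀ D ∈ 𝒟, D ≠ 0 ↔ bind₁ 𝒢 D ≠ 0

/-! ## Partial degrees -/

/-- The total degree in the variables `x`. -/
def degX {F : Type*} [Field F] {n ℓ : ℕ} (G : MvPolynomial (Fin n ⊕ Fin ℓ) F) : ℕ :=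
  weightedTotalDegree (Sum.elim (fun _ => 1) fun _ => 0) G

/-- The total degree in the variables `y`. -/
def degY {F : Type*} [Field F] {n ℓ : ℕ} (G : MvPolynomial (Fin n ⊕ Fin ℓ) F) : ℕ :=
  weightedTotalDegree (Sum.elim (fun _ => 0) fun _ => 1) G

end

/-! ## Building circuits node by node -/

section Circuits

variable {F : Type*} {σ : Type*}

/-- The polynomial at a node, given the polynomials at the origins of its wires. -/
noncomputable def CircuitNode.eval [Field F] {m : ℕ} (v : Fin m → MvPolynomial σ F) :
    CircuitNode F σ m → MvPolynomial σ F
  | .var i => X i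
  | .const c => C c
  | .add l _ => (l.map v).sum
  | .mul l _ => (l.map v).prod

theorem AlgCircuit.value_eq [Field F] (A : AlgCircuit F σ) (i : Fin A.numNodes) :
    A.value i = (A.node i).eval fun j : Fin i => A.value ⟨j, j.2.trans i.2⟩ := by
  rw [AlgCircuit.value]
  cases A.node i <;> rfl

/-- The circuit `A` with one more node. -/
def AlgCircuit.snoc (A : AlgCircuit F σ) (nd : CircuitNode F σ A.numNodes) :
    AlgCircuit F σ where
  numNodes := A.numNodes + 1
  node := Fin.lastCases (motive := fun i => CircuitNode F σ (i : ℕ)) nd fun j => A.node j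

namespace AlgCircuit

variable (A : AlgCircuit F σ) (nd : CircuitNode F σ A.numNodes)

theorem snoc_node_castSucc (i : Fin A.numNodes) :
    (A.snoc nd).node i.castSucc = A.node i :=
  Fin.lastCases_castSucc (motive := fun i => CircuitNode F σ (i : ℕ)) ..

theorem snoc_node_last : (A.snoc nd).node (Fin.last A.numNodes) = nd :=
  Fin.lastCases_last (motive := fun i => CircuitNode F σ (i : ℕ)) ..

theorem size_snoc : (A.snoc nd).size = A.size + nd.inputs.length := by
  refine (Fin.sum_univ_castSucc (n := A.numNodes) _).trans ?_
  congr 1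
  · exact Finset.sum_congr rfl fun i _ => by rw [snoc_node_castSucc]
  · rw [snoc_node_last]

theorem snoc_value_castSucc [Field F] (i : Fin A.numNodes) :
    (A.snoc nd).value i.castSucc = A.value i := by
  obtain ⟨i, hi⟩ := i
  induction i using Nat.strong_induction_on with
  | _ i ih =>
    refine ((A.snoc nd).value_eq _).trans ?_
    rw [A.value_eq, snoc_node_castSucc]
    change CircuitNode.eval (m := i) _ _ = CircuitNode.eval (m := i) _ _
    congr 1
    funext j
    exact ih j j.2 (j.2.trans hi)

theorem snoc_value_last [Field F] :
    (A.snoc nd).value (Fin.last A.numNodes) = nd.eval A.value := by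
  refine ((A.snoc nd).value_eq _).trans ?_
  rw [snoc_node_last]
  change CircuitNode.eval (m := A.numNodes) _ _ = _
  congr 1
  funext j
  exact A.snoc_value_castSucc nd j

theorem snoc_isOutput_last : (A.snoc nd).IsOutput (Fin.last A.numNodes) := fun i j _ =>
  (j.2.trans_le (Fin.le_last i)).ne

end AlgCircuit

variable [Field F]

/-- Some circuit with at most `m` wires computes all the polynomials in `S`. -/
def ComputesAll (S : Set (MvPolynomial σ F)) (m : ℕ) : Prop :=
  ∃ A : AlgCircuit F σ, A.size ≤ m ∧ ∀ p ∈ S, ∃ i, A.value i = p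

theorem ComputesAll.empty : ComputesAll (∅ : Set (MvPolynomial σ F)) 0 :=
  ⟨⟨0, fun i => i.elim0⟩, by simp [AlgCircuit.size], by simp⟩

theorem ComputesAll.mono {S T : Set (MvPolynomial σ F)} {m k : ℕ} (h : ComputesAll S m)
    (hT : T ⊆ S) (hk : m ≤ k) : ComputesAll T k := by
  obtain ⟨A, hA, hS⟩ := h
  exact ⟨A, hA.trans hk, fun p hp => hS p (hT hp)⟩

theorem AlgCircuit.computesAll_insert (A : AlgCircuit F σ) {S : Set (MvPolynomial σ F)}
    (hS : ∀ p ∈ S, ∃ i, A.value i = p) (nd : CircuitNode F σ A.numNodes) {m : ℕ}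
    (hm : A.size + nd.inputs.length ≤ m) : ComputesAll (insert (nd.eval A.value) S) m := by
  refine ⟨A.snoc nd, (A.size_snoc nd).trans_le hm, ?_⟩
  rintro p (rfl | hp)
  · exact ⟨_, A.snoc_value_last nd⟩
  · obtain ⟨i, rfl⟩ := hS p hp
    exact ⟨_, A.snoc_value_castSucc nd i⟩

theorem ComputesAll.insert_X {S : Set (MvPolynomial σ F)} {m : ℕ} (h : ComputesAll S m) (v : σ) :
    ComputesAll (insert (X v) S) m := by
  obtain ⟨A, hA, hS⟩ := h
  exact A.computesAll_insert hS (.var v) hA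

theorem ComputesAll.insert_C {S : Set (MvPolynomial σ F)} {m : ℕ} (h : ComputesAll S m) (c : F) :
    ComputesAll (insert (C c) S) m := by
  obtain ⟨A, hA, hS⟩ := h
  exact A.computesAll_insert hS (.const c) hA

theorem ComputesAll.insert_sum {S : Set (MvPolynomial σ F)} {m : ℕ} (h : ComputesAll S m)
    {l : List (MvPolynomial σ F)} (hl : ∀ p ∈ l, p ∈ S) :
    ComputesAll (insert l.sum S) (m + l.length) := by
  rcases eq_or_ne l [] with rfl | hne
  · simpa using h.insert_C 0
  obtain ⟨A, hA, hS⟩ := h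
  obtain ⟨l, rfl⟩ : l ∈ Set.range (List.map A.value) := by
    rw [Set.range_list_map]
    exact fun p hp => hS p (hl p hp)
  exact A.computesAll_insert hS (.add l (by simpa using hne))
    (by simpa [CircuitNode.inputs] using hA)

theorem ComputesAll.insert_prod {S : Set (MvPolynomial σ F)} {m : ℕ} (h : ComputesAll S m)
    {l : List (MvPolynomial σ F)} (hl : ∀ p ∈ l, p ∈ S) :
    ComputesAll (insert l.prod S) (m + l.length) := by
  rcases eq_or_ne l [] with rfl | hne
  · simpa using h.insert_C 1
  obtain ⟨A, hA, hS⟩ := h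
  obtain ⟨l, rfl⟩ : l ∈ Set.range (List.map A.value) := by
    rw [Set.range_list_map]
    exact fun p hp => hS p (hl p hp)
  exact A.computesAll_insert hS (.mul l (by simpa using hne))
    (by simpa [CircuitNode.inputs] using hA)

theorem ComputesAll.mem_circuitClass {S : Set (MvPolynomial σ F)} {m : ℕ} (h : ComputesAll S m)
    {p : MvPolynomial σ F} (hp : p ∈ S) : p ∈ circuitClass F σ (m + 1) := by
  obtain ⟨A, hA, hS⟩ := h
  obtain ⟨i, rfl⟩ := hS p hp
  refine ⟨A.snoc (.add [i] (by simp)), Fin.last A.numNodes, A.snoc_isOutput_last _, ?_, ?_⟩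
  · rw [A.size_snoc]
    simpa [CircuitNode.inputs] using hA
  · rw [A.snoc_value_last]
    simp [CircuitNode.eval]

/-- The polynomial `p` can be computed from the polynomials in `S` with `c` further wires. -/
def Derives (S : Set (MvPolynomial σ F)) (p : MvPolynomial σ F) (c : ℕ) : Prop :=
  ∀ T : Set (MvPolynomial σ F), S ⊆ T → ∀ m, ComputesAll T m → ComputesAll (insert p T) (m + c)

namespace Derives

variable {S : Set (MvPolynomial σ F)} {p : MvPolynomial σ F} {c : ℕ}

theorem mono (h : Derives S p c) {c' : ℕ} (hc : c ≤ c') : Derives S p c' :=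
  fun T hT m hm => (h T hT m hm).mono le_rfl (by omega)

theorem of_mem (h : p ∈ S) : Derives S p 0 := fun T hT m hm => by
  rwa [Set.insert_eq_of_mem (hT h)]

theorem X (v : σ) : Derives S (X v : MvPolynomial σ F) 0 := fun _ _ _ hm => hm.insert_X v

theorem all {l : List (MvPolynomial σ F)} (h : ∀ p ∈ l, Derives S p c)
    {T : Set (MvPolynomial σ F)} (hT : S ⊆ T) {m : ℕ} (hm : ComputesAll T m) :
    ComputesAll ({p | p ∈ l} ∪ T) (m + l.length * c) := by
  induction l with
  | nil => simpa using hm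
  | cons a l ih =>
    refine ((h a (by simp)) _ (hT.trans Set.subset_union_right) _
      (ih fun p hp => h p (by simp [hp]))).mono ?_ ?_
    · rintro p (hp | hp)
      · rcases List.mem_cons.1 hp with rfl | hp
        · exact Or.inl rfl
        · exact Or.inr (Or.inl hp)
      · exact Or.inr (Or.inr hp)
    · rw [List.length_cons]; linarith

theorem list_sum {l : List (MvPolynomial σ F)} (h : ∀ p ∈ l, Derives S p c) :
    Derives S l.sum (l.length * (c + 1)) := fun T hT m hm =>
  ((all h hT hm).insert_sum fun _ hp => Or.inl hp).mono
    (Set.insert_subset_insert Set.subset_union_right) (by linarith)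

theorem list_prod {l : List (MvPolynomial σ F)} (h : ∀ p ∈ l, Derives S p c) :
    Derives S l.prod (l.length * (c + 1)) := fun T hT m hm =>
  ((all h hT hm).insert_prod fun _ hp => Or.inl hp).mono
    (Set.insert_subset_insert Set.subset_union_right) (by linarith)

theorem sum {ι : Type*} {s : Finset ι} {f : ι → MvPolynomial σ F}
    (h : ∀ i ∈ s, Derives S (f i) c) : Derives S (∑ i ∈ s, f i) (s.card * (c + 1)) := by
  have := list_sum (l := s.toList.map f) (S := S) (c := c) (by simpa using h)
  rwa [Finset.sum_map_toList, List.length_map, Finset.length_toList] at this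

theorem mul {q : MvPolynomial σ F} (hp : Derives S p c) (hq : Derives S q c) :
    Derives S (p * q) (2 * (c + 1)) := by
  simpa using list_prod (l := [p, q]) (by simp [hp, hq])

theorem mul₃ {q r : MvPolynomial σ F} (hp : Derives S p c) (hq : Derives S q c)
    (hr : Derives S r c) : Derives S (p * (q * r)) (3 * (c + 1)) := by
  simpa using list_prod (l := [p, q, r]) (by simp [hp, hq, hr])

theorem add {q : MvPolynomial σ F} (hp : Derives S p c) (hq : Derives S q c) :
    Derives S (p + q) (2 * (c + 1)) := by
  simpa using list_sum (l := [p, q]) (by simp [hp, hq])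

end Derives

/-! ## Replacing variables by scalars -/

/-- Replace the second group of variables of a node by scalars. -/
def CircuitNode.specialize {τ : Type*} (α : τ → F) {m : ℕ} :
    CircuitNode F (σ ⊕ τ) m → CircuitNode F σ m
  | .var (.inl i) => .var i
  | .var (.inr j) => .const (α j)
  | .const c => .const c
  | .add l h => .add l h
  | .mul l h => .mul l h

omit [Field F] in
theorem CircuitNode.inputs_specialize {τ : Type*} (α : τ → F) {m : ℕ}
    (nd : CircuitNode F (σ ⊕ τ) m) : (nd.specialize α).inputs = nd.inputs := by
  rcases nd with (_ | _) | _ | _ | _ <;> rfl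

theorem specialize_mem_circuitClass {τ : Type*} (α : τ → F) {s : ℕ}
    {f : MvPolynomial (σ ⊕ τ) F} (hf : f ∈ circuitClass F (σ ⊕ τ) s) :
    aeval (Sum.elim X fun j => C (α j)) f ∈ circuitClass F σ s := by
  obtain ⟨A, o, ho, hs, rfl⟩ := hf
  let B : AlgCircuit F σ := ⟨A.numNodes, fun i => (A.node i).specialize α⟩
  have hB : ∀ i : Fin A.numNodes, (B.node i).inputs = (A.node i).inputs := fun i =>
    (A.node i).inputs_specialize α
  refine ⟨B, o, fun i j hj => ho i j ?_, ?_, ?_⟩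
  · rwa [← hB]
  · refine le_trans (le_of_eq ?_) hs
    exact Finset.sum_congr rfl fun i _ => by rw [hB]
  · obtain ⟨i, hi⟩ := o
    clear ho
    induction i using Nat.strong_induction_on with
    | _ i ih =>
      have ih' : (fun j : Fin i => B.value ⟨j, j.2.trans hi⟩) =
          fun j : Fin i => aeval (Sum.elim X fun j => C (α j)) (A.value ⟨j, j.2.trans hi⟩) :=
        funext fun j => ih j j.2 _
      rw [B.value_eq, A.value_eq]
      change ((A.node ⟨i, hi⟩).specialize α).eval (fun j : Fin i => B.value ⟨j, j.2.trans hi⟩) = _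
      rw [ih']
      rcases A.node ⟨i, hi⟩ with (_ | _) | _ | l | l <;>
        simp [CircuitNode.specialize, CircuitNode.eval, map_list_sum, map_list_prod,
          Function.comp_def, MvPolynomial.algebraMap_eq]

end Circuits

/-! ## Homogeneous components of the polynomials at the nodes of a circuit -/

section Decomposition

variable {F : Type*} [Field F] {σ : Type*}

theorem homogeneousComponent_mul (f g : MvPolynomial σ F) (k : ℕ) :
    homogeneousComponent k (f * g) = ∑ i ∈ Finset.range (k + 1),
      homogeneousComponent i f * homogeneousComponent (k - i) g := by
  classical
  ext m
  rw [coeff_homogeneousComponent]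
  simp only [coeff_sum, coeff_mul, coeff_homogeneousComponent]
  rw [Finset.sum_comm]
  by_cases hm : m.degree = k
  · rw [if_pos hm]
    refine Finset.sum_congr rfl fun x hx => ?_
    have hx' : x.1.degree + x.2.degree = k := by
      rw [← map_add, Finset.HasAntidiagonal.mem_antidiagonal.1 hx, hm]
    rw [Finset.sum_eq_single x.1.degree]
    · rw [if_pos rfl, if_pos (by omega)]
    · intro i _ hi
      rw [if_neg (Ne.symm hi), zero_mul]
    · intro h
      rw [Finset.mem_range] at h
      omega
  · rw [if_neg hm]
    refine (Finset.sum_eq_zero fun x hx => Finset.sum_eq_zero fun i hi => ?_).symm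
    have hx' : x.1.degree + x.2.degree = m.degree := by
      rw [← map_add, Finset.HasAntidiagonal.mem_antidiagonal.1 hx]
    rw [Finset.mem_range] at hi
    by_cases h1 : x.1.degree = i
    · rw [if_neg (c := x.2.degree = k - i) (by omega), mul_zero]
    · rw [if_neg h1, zero_mul]

theorem homogeneousComponent_one_mem_span (f : MvPolynomial σ F) :
    homogeneousComponent 1 f ∈ Submodule.span F (Set.range (X : σ → MvPolynomial σ F)) := by
  rw [homogeneousComponent_apply]
  refine Submodule.sum_mem _ fun m hm => ?_
  have : m ∈ Set.range fun i : σ => Finsupp.single i 1 := by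
    rw [Finsupp.range_single_one]
    exact (Finset.mem_filter.1 hm).2
  obtain ⟨i, rfl⟩ := this
  rw [← mul_one (coeff _ f), ← smul_eq_mul, ← smul_monomial]
  exact Submodule.smul_mem _ _ (Submodule.subset_span ⟨i, rfl⟩)

/-- The span of the products of homogeneous components of positive degrees with sum `k + 2` of
members of `T`. -/
noncomputable def productSpan (T : Set (MvPolynomial σ F)) (k : ℕ) :
    Submodule F (MvPolynomial σ F) :=
  Submodule.span F {p | ∃ u ∈ T, ∃ w ∈ T, ∃ i ≤ k,
    p = homogeneousComponent (i + 1) u * homogeneousComponent (k - i + 1) w}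

/-- The homogeneous components of degree at least `2` of `f` are linear combinations of products of
components of lower degrees of members of `T`. -/
def Decomposes (T : Set (MvPolynomial σ F)) (f : MvPolynomial σ F) : Prop :=
  ∀ k, homogeneousComponent (k + 2) f ∈ productSpan T k

variable {T : Set (MvPolynomial σ F)}

theorem homogeneousComponent_succ_C (k : ℕ) (c : F) :
    homogeneousComponent (k + 1) (C c : MvPolynomial σ F) = 0 :=
  homogeneousComponent_eq_zero _ _ (by simp)

theorem Decomposes.C (c : F) : Decomposes T (C c) := fun k => by
  rw [homogeneousComponent_succ_C]
  exact Submodule.zero_mem _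

theorem Decomposes.X (i : σ) : Decomposes T (X i) := fun k => by
  rw [homogeneousComponent_eq_zero _ _ (by simp)]
  exact Submodule.zero_mem _

theorem Decomposes.list_sum {l : List (MvPolynomial σ F)} (h : ∀ f ∈ l, Decomposes T f) :
    Decomposes T l.sum := fun k => by
  rw [map_list_sum]
  refine list_sum_mem fun p hp => ?_
  obtain ⟨f, hf, rfl⟩ := List.mem_map.1 hp
  exact h f hf k

theorem Decomposes.mul {f g : MvPolynomial σ F} (hf : Decomposes T f) (hg : Decomposes T g)
    (hfT : f ∈ T ∨ ∃ c, f = MvPolynomial.C c) (hgT : g ∈ T ∨ ∃ c, g = MvPolynomial.C c) :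
    Decomposes T (f * g) := fun k => by
  rw [homogeneousComponent_mul, Finset.sum_range_succ, Finset.sum_range_succ']
  refine Submodule.add_mem _ (Submodule.add_mem _ (Submodule.sum_mem _ fun i hi => ?_) ?_) ?_
  · rw [Finset.mem_range] at hi
    rcases hfT with hfT | ⟨c, rfl⟩
    · rcases hgT with hgT | ⟨c, rfl⟩
      · refine Submodule.subset_span ⟨f, hfT, g, hgT, i, by omega, ?_⟩
        rw [show k + 2 - (i + 1) = k - i + 1 by omega]
      · rw [show k + 2 - (i + 1) = k - i + 1 by omega, homogeneousComponent_succ_C, mul_zero]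
        exact Submodule.zero_mem _
    · rw [homogeneousComponent_succ_C, zero_mul]
      exact Submodule.zero_mem _
  · rw [homogeneousComponent_zero, ← smul_eq_C_mul]
    exact Submodule.smul_mem _ _ (hg k)
  · rw [Nat.sub_self, homogeneousComponent_zero, mul_comm, ← smul_eq_C_mul]
    exact Submodule.smul_mem _ _ (hf k)

theorem Decomposes.list_prod {l : List (MvPolynomial σ F)}
    (h : ∀ f ∈ l, Decomposes T f ∧ (f ∈ T ∨ ∃ c, f = MvPolynomial.C c))
    (hl : ∀ l', l' <:+ l → l' ≠ [] → l'.prod ∈ T) : Decomposes T l.prod := by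
  induction l with
  | nil => simpa using Decomposes.C (T := T) (1 : F)
  | cons a l ih =>
    rw [List.prod_cons]
    refine (h a (by simp)).1.mul (ih (fun f hf => h f (by simp [hf])) fun l' hl' =>
      hl l' (hl'.trans (List.suffix_cons a l))) (h a (by simp)).2 ?_
    rcases eq_or_ne l [] with rfl | hne
    · exact Or.inr ⟨1, by simp⟩
    · exact Or.inl (hl l (List.suffix_cons a l) hne)

/-- The value of a node, or for a multiplication node the products of the final segments of its list
of inputs. -/
noncomputable def CircuitNode.partialValues {m : ℕ} (v : Fin m → MvPolynomial σ F) :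
    CircuitNode F σ m → List (MvPolynomial σ F)
  | .var _ => []
  | .const _ => []
  | .add l _ => l.map fun _ => (l.map v).sum
  | .mul l _ => (List.range l.length).map fun j => ((l.map v).drop j).prod

theorem CircuitNode.length_partialValues {m : ℕ} (v : Fin m → MvPolynomial σ F)
    (nd : CircuitNode F σ m) : (nd.partialValues v).length = nd.inputs.length := by
  cases nd <;> simp [partialValues, inputs]

theorem CircuitNode.decomposes_partialValues {m : ℕ} (v : Fin m → MvPolynomial σ F)
    (nd : CircuitNode F σ m) (hT : ∀ p ∈ nd.partialValues v, p ∈ T) (hX : ∀ i, X i ∈ T)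
    (hv : ∀ j, Decomposes T (v j) ∧ (v j ∈ T ∨ ∃ c, v j = C c)) :
    (∀ p ∈ nd.partialValues v, Decomposes T p) ∧
      Decomposes T (nd.eval v) ∧ (nd.eval v ∈ T ∨ ∃ c, nd.eval v = C c) := by
  cases nd with
  | var i => exact ⟨by simp [partialValues], .X i, .inl (hX i)⟩
  | const c => exact ⟨by simp [partialValues], .C c, .inr ⟨c, rfl⟩⟩
  | add l hl =>
    obtain ⟨a, ha⟩ := List.exists_mem_of_ne_nil l hl
    have key : Decomposes T (l.map v).sum := .list_sum fun f hf => by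
      obtain ⟨j, -, rfl⟩ := List.mem_map.1 hf
      exact (hv j).1
    refine ⟨fun p hp => ?_, key, .inl (hT _ (List.mem_map.2 ⟨a, ha, rfl⟩))⟩
    obtain ⟨_, -, rfl⟩ := List.mem_map.1 hp
    exact key
  | mul l hl =>
    have hsuf : ∀ l', l' <:+ l.map v → l' ≠ [] → l'.prod ∈ T := fun l' hl' hne => by
      have hlen := List.length_pos_iff.2 hne
      have hle := hl'.length_le
      rw [List.length_map] at hle
      refine hT _ (List.mem_map.2 ⟨l.length - l'.length, List.mem_range.2 (by omega), ?_⟩)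
      have := List.suffix_iff_eq_drop.1 hl'
      rw [List.length_map] at this
      rw [← this]
    have key : ∀ l', l' <:+ l.map v → Decomposes T l'.prod := fun l' hl' =>
      .list_prod (fun f hf => by
        obtain ⟨j, -, rfl⟩ := List.mem_map.1 (hl'.subset hf)
        exact hv j) fun l'' h'' => hsuf l'' (h''.trans hl')
    refine ⟨fun p hp => ?_, key _ List.suffix_rfl, .inl (hsuf _ List.suffix_rfl (by simpa using hl))⟩
    obtain ⟨j, -, rfl⟩ := List.mem_map.1 hp
    exact key _ (List.drop_suffix _ _)

/-- Every polynomial that is computed by a circuit with at most `s` wires in `n` variables belongs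
to a family of `n + s + 1` polynomials each of which decomposes with respect to the family. -/
theorem exists_decomposing_family {n s : ℕ} {f : MvPolynomial (Fin n) F}
    (hf : f ∈ circuitClass F (Fin n) s) :
    ∃ g : Fin (n + s + 1) → MvPolynomial (Fin n) F, g 0 = f ∧
      ∀ t, Decomposes (Set.range g) (g t) := by
  obtain ⟨A, o, -, hs, rfl⟩ := hf
  let pv : Fin A.numNodes → List (MvPolynomial (Fin n) F) := fun i =>
    (A.node i).partialValues fun j : Fin i => A.value ⟨j, j.2.trans i.2⟩
  let L : List (MvPolynomial (Fin n) F) :=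
    A.value o :: ((List.finRange n).map X ++ (List.finRange A.numNodes).flatMap pv)
  have hL : L.length ≤ n + s + 1 := by
    have : ((List.finRange A.numNodes).flatMap pv).length = A.size := by
      rw [List.length_flatMap, AlgCircuit.size, ← List.ofFn_eq_map, List.sum_ofFn]
      exact Finset.sum_congr rfl fun i _ => CircuitNode.length_partialValues _ _
    simp only [L, List.length_cons, List.length_append, List.length_map, List.length_finRange, this]
    omega
  let g : Fin (n + s + 1) → MvPolynomial (Fin n) F := fun t => L.getD t 0
  have hgL : ∀ p ∈ L, p ∈ Set.range g := fun p hp => by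
    obtain ⟨j, hj, rfl⟩ := List.mem_iff_getElem.1 hp
    exact ⟨⟨j, hj.trans_le hL⟩, by simp [g, hj]⟩
  have hX : ∀ i, X i ∈ Set.range g := fun i => hgL _ (by simp [L])
  have hpv : ∀ i, ∀ p ∈ pv i, p ∈ Set.range g := fun i p hp => hgL p (by
    simp only [L, List.mem_cons, List.mem_append, List.mem_flatMap]
    exact .inr (.inr ⟨i, List.mem_finRange i, hp⟩))
  have key : ∀ i, Decomposes (Set.range g) (A.value i) ∧
      (A.value i ∈ Set.range g ∨ ∃ c, A.value i = C c) := by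
    rintro ⟨i, hi⟩
    induction i using Nat.strong_induction_on with
    | _ i ih =>
      rw [A.value_eq]
      exact ((A.node ⟨i, hi⟩).decomposes_partialValues _ (hpv ⟨i, hi⟩) hX
        fun j => ih j j.2 (j.2.trans hi)).2
  refine ⟨g, rfl, fun t => ?_⟩
  have hmem : g t ∈ L ∨ g t = 0 := by
    by_cases ht : (t : ℕ) < L.length
    · exact .inl (by simp [g, ht])
    · exact .inr (by simp [g, not_lt.1 ht])
  rcases hmem with hmem | hmem
  · simp only [L, List.mem_cons, List.mem_append, List.mem_map, List.mem_flatMap] at hmem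
    rcases hmem with h | ⟨i, -, h⟩ | ⟨i, -, h⟩
    · rw [h]; exact (key o).1
    · rw [← h]; exact .X i
    · exact ((A.node i).decomposes_partialValues _ (hpv i) hX
        fun j => key ⟨j, j.2.trans i.2⟩).1 _ h
  · rw [hmem, ← C_0]
    exact .C 0

end Decomposition

/-! ## The universal circuit -/

section Universal

variable {F : Type*} [Field F] {n N : ℕ} {ρ : Type*}

/-- The generic polynomial at the `t`-th node in degree `k + 1`: the generic linear form for
`k = 0`, and otherwise the generic combination of products of such polynomials of lower degrees. The
variables `yA` and `yB` stand for the coefficients. -/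
noncomputable def genericComponent (F : Type*) [Field F] (yA : Fin N → Fin n → ρ)
    (yB : Fin N → ℕ → Fin N → Fin N → ℕ → ρ) : ℕ → Fin N → MvPolynomial (Fin n ⊕ ρ) F
  | 0, t => ∑ m, X (Sum.inr (yA t m)) * X (Sum.inl m)
  | k + 1, t => ∑ x : Fin N × Fin N × Fin (k + 1), X (Sum.inr (yB t k x.1 x.2.1 x.2.2)) *
      (genericComponent F yA yB x.2.2 x.1 * genericComponent F yA yB (k - x.2.2) x.2.1)
termination_by k => k
decreasing_by
  · exact x.2.2.isLt
  · omega

variable (yA : Fin N → Fin n → ρ) (yB : Fin N → ℕ → Fin N → Fin N → ℕ → ρ)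

theorem genericComponent_isWeightedHomogeneous_x (k : ℕ) (t : Fin N) :
    IsWeightedHomogeneous (Sum.elim (fun _ => 1) fun _ => 0 : Fin n ⊕ ρ → ℕ)
      (genericComponent F yA yB k t) (k + 1) := by
  induction k using Nat.strong_induction_on generalizing t with
  | _ k ih =>
    cases k with
    | zero =>
      rw [genericComponent]
      refine .sum _ _ _ fun m _ => ?_
      simpa using (isWeightedHomogeneous_X F (Sum.elim (fun _ => 1) fun _ => 0 : Fin n ⊕ ρ → ℕ)
        (Sum.inr (yA t m))).mul (isWeightedHomogeneous_X F _ (Sum.inl m))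
    | succ k =>
      rw [genericComponent]
      refine .sum _ _ _ fun x _ => ?_
      have hx := x.2.2.isLt
      convert (isWeightedHomogeneous_X F (Sum.elim (fun _ => 1) fun _ => 0 : Fin n ⊕ ρ → ℕ)
        (Sum.inr (yB t k x.1 x.2.1 x.2.2))).mul
          ((ih x.2.2 hx x.1).mul (ih (k - x.2.2) (by omega) x.2.1)) using 1
      simp only [Sum.elim_inr]
      omega

theorem genericComponent_isWeightedHomogeneous_y (k : ℕ) (t : Fin N) :
    IsWeightedHomogeneous (Sum.elim (fun _ => 0) fun _ => 1 : Fin n ⊕ ρ → ℕ)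
      (genericComponent F yA yB k t) (2 * k + 1) := by
  induction k using Nat.strong_induction_on generalizing t with
  | _ k ih =>
    cases k with
    | zero =>
      rw [genericComponent]
      refine .sum _ _ _ fun m _ => ?_
      simpa using (isWeightedHomogeneous_X F (Sum.elim (fun _ => 0) fun _ => 1 : Fin n ⊕ ρ → ℕ)
        (Sum.inr (yA t m))).mul (isWeightedHomogeneous_X F _ (Sum.inl m))
    | succ k =>
      rw [genericComponent]
      refine .sum _ _ _ fun x _ => ?_
      have hx := x.2.2.isLt
      convert (isWeightedHomogeneous_X F (Sum.elim (fun _ => 0) fun _ => 1 : Fin n ⊕ ρ → ℕ)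
        (Sum.inr (yB t k x.1 x.2.1 x.2.2))).mul
          ((ih x.2.2 hx x.1).mul (ih (k - x.2.2) (by omega) x.2.1)) using 1
      simp only [Sum.elim_inr]
      omega

theorem genericComponent_derives {d k : ℕ} (hk : k < d) (t : Fin N) :
    Derives {p | ∃ j < k, ∃ u, p = genericComponent F yA yB j u} (genericComponent F yA yB k t)
      (3 * n + 4 * N ^ 2 * d) := by
  cases k with
  | zero =>
    rw [genericComponent]
    refine (Derives.sum fun m _ => (Derives.X _).mul (Derives.X _)).mono ?_
    rw [Finset.card_univ, Fintype.card_fin]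
    nlinarith [Nat.zero_le (4 * N ^ 2 * d)]
  | succ k =>
    rw [genericComponent]
    refine (Derives.sum (c := 3) fun x _ => (Derives.X _).mul₃ (Derives.of_mem ?_)
      (Derives.of_mem ?_)).mono ?_
    · exact ⟨_, x.2.2.isLt, _, rfl⟩
    · exact ⟨k - x.2.2, by omega, _, rfl⟩
    · rw [Finset.card_univ, Fintype.card_prod, Fintype.card_prod, Fintype.card_fin, Fintype.card_fin]
      calc N * (N * (k + 1)) * (3 + 1) = 4 * N ^ 2 * (k + 1) := by ring
        _ ≤ 4 * N ^ 2 * d := Nat.mul_le_mul_left _ hk.le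
        _ ≤ _ := Nat.le_add_left _ _

theorem genericComponent_computesAll {d : ℕ} : ∀ k ≤ d,
    ComputesAll {p | ∃ j < k, ∃ u, p = genericComponent F yA yB j u}
      (k * (N * (3 * n + 4 * N ^ 2 * d))) := by
  intro k hk
  induction k with
  | zero => simpa using ComputesAll.empty
  | succ k ih =>
    refine (Derives.all (c := 3 * n + 4 * N ^ 2 * d)
      (l := (List.finRange N).map (genericComponent F yA yB k)) ?_ le_rfl
      (ih (by omega))).mono ?_ ?_
    · intro p hp
      obtain ⟨t, -, rfl⟩ := List.mem_map.1 hp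
      exact genericComponent_derives yA yB hk t
    · rintro p ⟨j, hj, u, rfl⟩
      rcases Nat.lt_succ_iff_lt_or_eq.1 hj with hj | rfl
      · exact .inr ⟨j, hj, u, rfl⟩
      · exact .inl (List.mem_map.2 ⟨u, List.mem_finRange u, rfl⟩)
    · rw [List.length_map, List.length_finRange]
      exact le_of_eq (by ring)

/-- The sum of a generic constant and the generic polynomials of degree at most `d` at a node. -/
noncomputable def universalPoly (F : Type*) [Field F] (y₀ : ρ) (yA : Fin N → Fin n → ρ)
    (yB : Fin N → ℕ → Fin N → Fin N → ℕ → ρ) (d : ℕ) (t : Fin N) : MvPolynomial (Fin n ⊕ ρ) F :=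
  X (Sum.inr y₀) + ∑ k ∈ Finset.range d, genericComponent F yA yB k t

variable (y₀ : ρ) (d : ℕ) (t : Fin N)

theorem universalPoly_mem_circuitClass :
    universalPoly F y₀ yA yB d t ∈ circuitClass F (Fin n ⊕ ρ)
      (d * (N * (3 * n + 4 * N ^ 2 * d)) + 2 * (d + 1) + 1) := by
  have h : Derives {p | ∃ j < d, ∃ u, p = genericComponent F yA yB j u}
      (universalPoly F y₀ yA yB d t) (2 * (d + 1)) := by
    refine ((Derives.X _).mono (Nat.zero_le d)).add ?_
    simpa using Derives.sum (S := {p | ∃ j < d, ∃ u, p = genericComponent F yA yB j u})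
      (s := Finset.range d) (c := 0) (f := fun k => genericComponent F yA yB k t) fun k hk =>
        Derives.of_mem ⟨k, Finset.mem_range.1 hk, t, rfl⟩
  exact (h _ le_rfl _ (genericComponent_computesAll yA yB d le_rfl)).mem_circuitClass (.inl rfl)

theorem weightedTotalDegree_universalPoly_le {w : Fin n ⊕ ρ → ℕ} {b : ℕ}
    (h₀ : w (Sum.inr y₀) ≤ b) {e : ℕ → ℕ} (he : ∀ k < d, e k ≤ b)
    (h : ∀ k, IsWeightedHomogeneous w (genericComponent F yA yB k t) (e k)) :
    weightedTotalDegree w (universalPoly F y₀ yA yB d t) ≤ b := by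
  classical
  refine Finset.sup_le fun m hm => ?_
  rw [mem_support_iff, universalPoly, coeff_add, coeff_sum] at hm
  by_contra hb
  refine hm ?_
  rw [(isWeightedHomogeneous_X F w (Sum.inr y₀)).coeff_eq_zero _ (by omega), zero_add]
  refine Finset.sum_eq_zero fun k hk => (h k).coeff_eq_zero _ ?_
  have := he k (Finset.mem_range.1 hk)
  omega

theorem aeval_genericComponent {g : Fin N → MvPolynomial (Fin n) F} {α : ρ → F} {d : ℕ}
    (hA : ∀ t, ∑ m, α (yA t m) • X m = homogeneousComponent 1 (g t))
    (hB : ∀ t, ∀ k < d, ∑ x : Fin N × Fin N × Fin (k + 1), α (yB t k x.1 x.2.1 x.2.2) •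
      (homogeneousComponent (x.2.2 + 1) (g x.1) *
        homogeneousComponent (k - x.2.2 + 1) (g x.2.1)) = homogeneousComponent (k + 2) (g t)) :
    ∀ k ≤ d, ∀ t, aeval (Sum.elim X fun j => C (α j)) (genericComponent F yA yB k t) =
      homogeneousComponent (k + 1) (g t) := by
  intro k
  induction k using Nat.strong_induction_on with
  | _ k ih =>
    intro hk t
    cases k with
    | zero =>
      rw [genericComponent, zero_add, ← hA t, map_sum]
      exact Finset.sum_congr rfl fun m _ => by simp [smul_eq_C_mul]
    | succ k =>
      rw [genericComponent, ← hB t k hk, map_sum]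
      refine Finset.sum_congr rfl fun x _ => ?_
      have hx := x.2.2.isLt
      rw [map_mul, map_mul, ih _ hx (by omega), ih (k - x.2.2) (by omega) (by omega), aeval_X,
        Sum.elim_inr, smul_eq_C_mul]

theorem sum_homogeneousComponent_eq {f : MvPolynomial (Fin n) F} {d : ℕ}
    (hf : f.totalDegree ≤ d) :
    C (coeff 0 f) + ∑ k ∈ Finset.range d, homogeneousComponent (k + 1) f = f := by
  rw [← homogeneousComponent_zero, add_comm, ← Finset.sum_range_succ' fun k =>
    homogeneousComponent k f]
  conv_rhs => rw [← sum_homogeneousComponent f]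
  refine (Finset.sum_subset (Finset.range_subset_range.2 (by omega)) fun k _ hk => ?_).symm
  rw [Finset.mem_range] at hk
  exact homogeneousComponent_eq_zero _ _ (by omega)

theorem exists_aeval_universalPoly_eq {g : Fin N → MvPolynomial (Fin n) F}
    (hg : ∀ t, Decomposes (Set.range g) (g t))
    {e : Option (Fin N × Fin n ⊕ Fin N × Fin d × Fin N × Fin N × Fin d) → ρ}
    (he : Function.Injective e) (he₀ : e none = y₀) (heA : ∀ t m, e (some (.inl (t, m))) = yA t m)
    (heB : ∀ t k u w i, e (some (.inr (t, k, u, w, i))) = yB t k u w i)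
    (hd : (g t).totalDegree ≤ d) :
    ∃ α : ρ → F, aeval (Sum.elim X fun j => C (α j)) (universalPoly F y₀ yA yB d t) = g t := by
  have hA : ∀ t, ∃ a : Fin n → F, ∑ m, a m • X m = homogeneousComponent 1 (g t) := fun t =>
    (Submodule.mem_span_range_iff_exists_fun F).1 (homogeneousComponent_one_mem_span (g t))
  choose a ha using hA
  have hB : ∀ t (k : ℕ), ∃ b : Fin N × Fin N × Fin (k + 1) → F, ∑ x, b x •
      (homogeneousComponent (x.2.2 + 1) (g x.1) *
        homogeneousComponent (k - x.2.2 + 1) (g x.2.1)) = homogeneousComponent (k + 2) (g t) := by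
    intro t k
    refine (Submodule.mem_span_range_iff_exists_fun F).1 (Submodule.span_mono ?_ (hg t k))
    rintro p ⟨_, ⟨u, rfl⟩, _, ⟨w, rfl⟩, i, hi, rfl⟩
    exact ⟨(u, w, ⟨i, by omega⟩), rfl⟩
  choose b hb using hB
  let β : Option (Fin N × Fin n ⊕ Fin N × Fin d × Fin N × Fin N × Fin d) → F
    | none => coeff 0 (g t)
    | some (.inl (t, m)) => a t m
    | some (.inr (t, k, u, w, i)) => if h : (i : ℕ) < k + 1 then b t k (u, w, ⟨i, h⟩) else 0
  have hα : ∀ y, Function.extend e β 0 (e y) = β y := fun y => he.extend_apply _ _ _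
  refine ⟨Function.extend e β 0, ?_⟩
  have key := aeval_genericComponent (d := d - 1) yA yB (g := g) (α := Function.extend e β 0)
    (fun t => by simp only [← heA, hα]; exact ha t) fun t k hk => by
      rw [← hb t k]
      refine Finset.sum_congr rfl fun x _ => ?_
      have hx := x.2.2.isLt
      have := heB t ⟨k, by omega⟩ x.1 x.2.1 ⟨x.2.2, by omega⟩
      simp only at this
      rw [← this, hα]
      simp only [β, dif_pos hx]
  rw [universalPoly, map_add, map_sum, aeval_X, Sum.elim_inr, ← he₀, hα]
  rw [Finset.sum_congr rfl fun k hk => key k (by rw [Finset.mem_range] at hk; omega) t]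
  exact sum_homogeneousComponent_eq hd

end Universal

/-! ## Generators from polynomials in two groups of variables -/

section Generator

variable {F : Type*} [Field F] {n r d : ℕ}

theorem support_subset_monomialsLE_iff {f : MvPolynomial (Fin n) F} :
    f.support ⊆ monomialsLE n d ↔ f.totalDegree ≤ d := by
  simp only [Finset.subset_iff, mem_monomialsLE, totalDegree, Finset.sup_le_iff]
  refine forall₂_congr fun a _ => ?_
  rw [Finsupp.sum_fintype _ _ fun _ => rfl]

theorem exists_eq_generatorPoly {U : MvPolynomial (Fin n ⊕ Fin r) F} (hU : degX U ≤ d) :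
    ∃ 𝒢 : monomialsLE n d → MvPolynomial (Fin r) F, U = generatorPoly 𝒢 := by
  classical
  let π : (Fin n ⊕ Fin r →₀ ℕ) → (Fin n →₀ ℕ) := fun m => (Finsupp.sumFinsuppEquivProdFinsupp m).1
  let π' : (Fin n ⊕ Fin r →₀ ℕ) → (Fin r →₀ ℕ) := fun m => (Finsupp.sumFinsuppEquivProdFinsupp m).2
  have hπ : ∀ m ∈ U.support, π m ∈ monomialsLE n d := fun m hm => by
    rw [mem_monomialsLE]
    refine le_trans ?_ ((le_weightedTotalDegree _ hm).trans hU)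
    rw [Finsupp.weight_apply, Finsupp.sum_fintype _ _ (by simp)]
    simp [π]
  refine ⟨fun a => ∑ m ∈ U.support with π m = a, monomial (π' m) (coeff m U), ?_⟩
  have hmon : ∀ m : Fin n ⊕ Fin r →₀ ℕ, monomial m (coeff m U) =
      rename Sum.inr (monomial (π' m) (coeff m U)) *
        rename Sum.inl (monomial (π m) (1 : F)) := fun m => by
    rw [rename_monomial, rename_monomial, monomial_mul, mul_one]
    refine congrArg (fun k => monomial k (coeff m U)) (Finsupp.ext ?_)
    rintro (i | j)
    · rw [Finsupp.add_apply, Finsupp.mapDomain_of_notMem_range _ _ (by simp),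
        Finsupp.mapDomain_apply Sum.inl_injective]
      simp [π]
    · rw [Finsupp.add_apply, Finsupp.mapDomain_apply Sum.inr_injective,
        Finsupp.mapDomain_of_notMem_range _ _ (by simp)]
      simp [π']
  rw [generatorPoly, Finset.sum_coe_sort (monomialsLE n d) fun a =>
    rename Sum.inr (∑ m ∈ U.support with π m = a, monomial (π' m) (coeff m U)) *
      rename Sum.inl (monomial a (1 : F))]
  conv_lhs => rw [U.as_sum, ← Finset.sum_fiberwise_of_maps_to hπ]
  refine Finset.sum_congr rfl fun a _ => ?_
  rw [map_sum, Finset.sum_mul]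
  refine Finset.sum_congr rfl fun m hm => ?_
  rw [hmon m, (Finset.mem_filter.1 hm).2]

variable (𝒢 : monomialsLE n d → MvPolynomial (Fin r) F) (α : Fin r → F)

theorem specializeY_generatorPoly :
    specializeY α (generatorPoly 𝒢) =
      ∑ a : monomialsLE n d, monomial (a : Fin n →₀ ℕ) (eval α (𝒢 a)) := by
  rw [specializeY, generatorPoly, map_sum]
  refine Finset.sum_congr rfl fun a _ => ?_
  have h₁ : aeval (fun j => C (α j)) (𝒢 a) = (C (eval α (𝒢 a)) : MvPolynomial (Fin n) F) := by
    rw [← aeval_eq_eval]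
    exact aeval_algebraMap_apply (MvPolynomial (Fin n) F) α (𝒢 a)
  have h₂ : aeval (X : Fin n → MvPolynomial (Fin n) F) (monomial (a : Fin n →₀ ℕ) (1 : F)) =
      monomial (a : Fin n →₀ ℕ) 1 := by rw [aeval_X_left, AlgHom.id_apply]
  rw [map_mul, aeval_rename, aeval_rename, Sum.elim_comp_inr, Sum.elim_comp_inl, h₁, h₂,
    C_mul_monomial, mul_one]

theorem coeffVec_specializeY_generatorPoly :
    coeffVec (monomialsLE n d) (specializeY α (generatorPoly 𝒢)) = fun a => eval α (𝒢 a) := by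
  classical
  funext a
  rw [coeffVec, specializeY_generatorPoly, coeff_sum]
  simp [coeff_monomial]

theorem totalDegree_specializeY_generatorPoly_le :
    (specializeY α (generatorPoly 𝒢)).totalDegree ≤ d := by
  rw [specializeY_generatorPoly]
  refine totalDegree_finsetSum_le fun a _ => (totalDegree_monomial_le _ _).trans ?_
  rw [Finsupp.sum_fintype _ _ fun _ => rfl]
  exact mem_monomialsLE.1 a.2

/-- If the coefficient polynomials `𝒢` specialize to every polynomial of a succinct hitting set, then
they form a generator. -/
theorem isSuccinctGenerator_of_universal {s s' : ℕ}
    (hG : generatorPoly 𝒢 ∈ circuitClass F (Fin n ⊕ Fin r) s')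
    (huniv : ∀ f ∈ boundedCircuitClass F n d s, ∃ α : Fin r → F,
      f = specializeY α (generatorPoly 𝒢))
    {𝒟 : Set (MvPolynomial (monomialsLE n d) F)}
    (h𝒟 : IsSuccinctHittingSet (monomialsLE n d) (boundedCircuitClass F n d s) 𝒟) :
    IsSuccinctGenerator (boundedCircuitClass F n d s') (circuitClass F (Fin n ⊕ Fin r) s') 𝒟 𝒢 where
  subset_span _ hf := support_subset_monomialsLE_iff.2 hf.1
  computable := hG
  succinct α := ⟨totalDegree_specializeY_generatorPoly_le 𝒢 α, specialize_mem_circuitClass α hG⟩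
  generates D hD := by
    refine ⟨fun hne => ?_, fun hne h => hne (by rw [h, map_zero])⟩
    obtain ⟨f, hf, hfD⟩ := (h𝒟.2 D hD).1 hne
    obtain ⟨α, rfl⟩ := huniv f hf
    rw [coeffVec_specializeY_generatorPoly] at hfD
    intro h
    refine hfD ?_
    have h' := congrArg (eval α) h
    rw [map_zero] at h'
    rw [← h', ← coe_aeval_eq_eval, ← coe_aeval_eq_eval, RingHom.coe_coe, RingHom.coe_coe,
      aeval_bind₁]

end Generator

theorem mainTheorem2 :
    ∃ (p : MvPolynomial (Fin 3) ℕ) (q : Polynomial ℕ),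
      ∀ (F : Type*) [Field F] (n d s : ℕ), 1 ≤ n → 1 ≤ s →
        ∃ (r : ℕ) (U : MvPolynomial (Fin n ⊕ Fin r) F)
          (𝒢 : monomialsLE n d → MvPolynomial (Fin r) F),
          r ≤ MvPolynomial.eval ![n, d, s] p ∧
          U ∈ circuitClass F (Fin n ⊕ Fin r) (MvPolynomial.eval ![n, d, s] p) ∧
          degX U ≤ d ∧
          degY U ≤ q.eval d ∧
          (∀ f ∈ boundedCircuitClass F n d s, ∃ α : Fin r → F, f = specializeY α U) ∧
          U = generatorPoly 𝒢 ∧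
          ∀ 𝒟 : Set (MvPolynomial (monomialsLE n d) F),
            IsSuccinctHittingSet (monomialsLE n d) (boundedCircuitClass F n d s) 𝒟 →
              IsSuccinctGenerator
                (boundedCircuitClass F n d (MvPolynomial.eval ![n, d, s] p))
                (circuitClass F (Fin n ⊕ Fin r) (MvPolynomial.eval ![n, d, s] p)) 𝒟 𝒢 := by
  let pN : MvPolynomial (Fin 3) ℕ := X 0 + X 2 + 1
  let p₁ : MvPolynomial (Fin 3) ℕ := pN * X 0 + pN * (X 1 * (pN * (pN * X 1))) + 1
  let p₂ : MvPolynomial (Fin 3) ℕ :=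
    X 1 * (pN * (3 * X 0 + 4 * pN ^ 2 * X 1)) + 2 * (X 1 + 1) + 1
  refine ⟨p₁ + p₂, 2 * Polynomial.X + 1, fun F _ n d s _ _ => ?_⟩
  let N := n + s + 1
  let ι := Option (Fin N × Fin n ⊕ Fin N × Fin d × Fin N × Fin N × Fin d)
  have hp₁ : MvPolynomial.eval ![n, d, s] p₁ = Fintype.card ι := by
    simp [p₁, pN, ι, N]
  have hp₂ : MvPolynomial.eval ![n, d, s] p₂ =
      d * (N * (3 * n + 4 * N ^ 2 * d)) + 2 * (d + 1) + 1 := by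
    simp [p₂, pN, N]
  let e : ι ≃ Fin (Fintype.card ι) := Fintype.equivFin ι
  let yA : Fin N → Fin n → Fin (Fintype.card ι) := fun t m => e (some (.inl (t, m)))
  let yB : Fin N → ℕ → Fin N → Fin N → ℕ → Fin (Fintype.card ι) := fun t k u w i =>
    if h : k < d ∧ i < d then e (some (.inr (t, ⟨k, h.1⟩, u, w, ⟨i, h.2⟩))) else e none
  let U := universalPoly F (e none) yA yB d 0
  have hUX : degX U ≤ d := weightedTotalDegree_universalPoly_le _ _ _ _ _ (by simp)
    (fun k hk => Nat.succ_le_of_lt hk) fun k => genericComponent_isWeightedHomogeneous_x yA yB k 0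
  have hUY : degY U ≤ 2 * d + 1 := weightedTotalDegree_universalPoly_le _ _ _ _ _ (by simp)
    (fun k hk => by omega) fun k => genericComponent_isWeightedHomogeneous_y yA yB k 0
  have hUC : U ∈ circuitClass F (Fin n ⊕ Fin (Fintype.card ι))
      (MvPolynomial.eval ![n, d, s] (p₁ + p₂)) := by
    obtain ⟨A, o, ho, hA, hv⟩ := universalPoly_mem_circuitClass (F := F) yA yB (e none) d 0
    refine ⟨A, o, ho, hA.trans ?_, hv⟩
    rw [map_add, hp₂]
    exact Nat.le_add_left _ _
  have huniv : ∀ f ∈ boundedCircuitClass F n d s, ∃ α : Fin (Fintype.card ι) → F,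
      f = specializeY α U := fun f hf => by
    obtain ⟨g, rfl, hg⟩ := exists_decomposing_family hf.2
    obtain ⟨α, hα⟩ := exists_aeval_universalPoly_eq yA yB (e none) d 0 hg e.injective rfl
      (fun _ _ => rfl) (fun t k u w i => by simp [yB]) hf.1
    exact ⟨α, hα.symm⟩
  obtain ⟨𝒢, h𝒢⟩ := exists_eq_generatorPoly hUX
  refine ⟨Fintype.card ι, U, 𝒢, ?_, hUC, hUX, by simpa using hUY, huniv, h𝒢, fun 𝒟 h𝒟 => ?_⟩
  · rw [map_add, hp₁]
    exact Nat.le_add_right _ _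
  · exact isSuccinctGenerator_of_universal 𝒢 (h𝒢 ▸ hUC) (h𝒢 ▸ huniv) h𝒟
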